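/- Let $\Sigma,\Gamma$ be finite alphabets, let $\mathcal D$ be a countably infinite set of data values, and let $d_0\in\mathcal D$. For a finite set $R$ of registers, a test over $R$ is a Boolean formula (built from $\top,\bot,\wedge,\vee,\neg$) over the atoms $r^{=}$ and $r^{\neq}$ with $r\in R$; a datum $d$ satisfies $r^{=}$ (resp. $r^{\neq}$) in a valuation $\tau:R\to\mathcal D$ if $\tau(r)=d$ (resp. $\tau(r)\neq d$). A non-deterministic register transducer (NRT) is $T=(Q,R,i_0,F,\Delta)$ with $Q$ a finite set of states, $R$ a finite set of registers, $i_0\in Q$, $F\subseteq Q$, and $\Delta$ a finite set of transitions $(q,\sigma,\phi,\mathsf{asgn},o,q')$, where $q,q'\in Q$, $\sigma\in\Sigma$, $\phi$ is a test over $R$, $\mathsf{asgn}\subseteq R$ and $o\in(\Gamma\times R)^*$. A configuration is a pair $(q,\tau)$ with $q\in Q$ and $\tau:R\to\mathcal D$. By such a transition, $T$ can move from $(q,\tau)$ to $(q',\tau')$ reading $(\sigma,d)\in\Sigma\times\mathcal D$ and writing $w\in(\Gamma\times\mathcal D)^*$ if $d$ satisfies $\phi$ in $\tau$, if $\tau'(r)=d$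 for $r\in\mathsf{asgn}$ and $\tau'(r)=\tau(r)$ for $r\notin\mathsf{asgn}$, and if $w$ is obtained from $o$ by replacing every $(\gamma,r)$ with $(\gamma,\tau'(r))$. A run is an infinite sequence of such moves; its input is the infinite word of the letters read, and its output is the concatenation of the words written. It is accepting if it starts in $(i_0,\tau_0)$, where $\tau_0(r)=d_0$ for all $r\in R$, and if some state of $F$ occurs infinitely often in it. Assume that every accepting run of $T$ has an infinite output, and that $T$ is functional, that is, that the set of pairs (input, output) of accepting runs is the graph of a partial function $f:(\Sigma\times\mathcal D)^\omega\rightharpoonup(\Gamma\times\mathcal D)^\omega$. For infinite words $u,v$ let $|u\wedge v|\in\mathbb N\cup\{\infty\}$ be the length of their longest common prefix. We say that $T$ is not continuous at $x$ if $x\in\mathrm{dom}(f)$ and it is not the case that $$\forall i\ge 0\ \exists j\ge 0\ \forall y\in\mathrm{dom}(f):\quad |x\wedge y|\ge j\ \Rightarrow\ |f(x)\wedge f(y)|\ge i .$$ **Theorem.** Let $T$ be a functional NRT with $k$ registers, all of whose accepting runs have infinite output. Then for every $X\subseteq\mathcal D$ (finite or infinite) with $|X|\ge 2k+3$ and $d_0\in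 X$, $T$ is not continuous at some $x\in(\Sigma\times\mathcal D)^\omega$ if and only if $T$ is not continuous at some $z\in(\Sigma\times X)^\omega$. -/

import Mathlib

/-! ## Words -/

/-- Infinite words over the alphabet `S`; letters are numbered from `0`. -/
abbrev OmegaWord (S : Type*) := ℕ → S

/-- The length, in `ℕ ∪ {∞}`, of the longest common prefix of two infinite words. -/
noncomputable def lcpLength {S : Type*} (u v : OmegaWord S) : ℕ∞ :=
  ⨆ (n : ℕ) (_ : ∀ m < n, u m = v m), (n : ℕ∞)

theorem le_lcpLength_iff {S : Type*} (u v : OmegaWord S) (n : ℕ) :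
    (n : ℕ∞) ≤ lcpLength u v ↔ ∀ m < n, u m = v m := by
  constructor
  · intro h m hm
    have h1 : (m : ℕ∞) < lcpLength u v :=
      lt_of_lt_of_le (by exact_mod_cast hm) h
    unfold lcpLength at h1
    rw [lt_iSup_iff] at h1
    obtain ⟨p, hp⟩ := h1
    rw [lt_iSup_iff] at hp
    obtain ⟨hp1, hp2⟩ := hp
    exact hp1 m (by exact_mod_cast hp2)
  · intro h
    exact le_iSup₂_of_le n h le_rfl

/-- The finite word `v 0 ⋯ v (n - 1)`, for a sequence `v` of finite words. -/
def concatUpTo {S : Type*} (v : ℕ → List S) (n : ℕ) : List S :=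
  (List.range n).flatMap v

/-- The concatenation `v 0 · v 1 · v 2 ⋯` of a sequence of finite words is an infinite word. -/
def HasInfiniteConcat {S : Type*} (v : ℕ → List S) : Prop :=
  ∀ i : ℕ, ∃ n : ℕ, i < (concatUpTo v n).length

/-- The concatenation `v 0 · v 1 · v 2 ⋯` is the infinite word `w`: every position of `w` is
a position of some finite concatenation `v 0 ⋯ v (n - 1)`, with the same letter there. -/
def IsInfiniteConcat {S : Type*} (v : ℕ → List S) (w : OmegaWord S) : Prop :=
  ∀ i : ℕ, ∃ n : ℕ, (concatUpTo v n)[i]? = some (w i)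

/-! ## Register transducers -/

/-- Tests over a set `R` of registers. -/
inductive RegTest (R : Type*) where
  | top : RegTest R
  | bot : RegTest R
  | eq (r : R) : RegTest R
  | ne (r : R) : RegTest R
  | and (φ ψ : RegTest R) : RegTest R
  | or (φ ψ : RegTest R) : RegTest R
  | not (φ : RegTest R) : RegTest R

/-- `φ.Sat τ d`: the data value `d` satisfies the test `φ` in the valuation `τ`. -/
def RegTest.Sat {R D : Type*} (τ : R → D) (d : D) : RegTest R → Prop
  | .top => True
  | .bot => False
  | .eq r => τ r = d
  | .ne r => τ r ≠ d
  | .and φ ψ => φ.Sat τ d ∧ ψ.Sat τ d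
  | .or φ ψ => φ.Sat τ d ∨ ψ.Sat τ d
  | .not φ => ¬ φ.Sat τ d

/-- Transitions with input labels in `A`, output labels in `B`, states in `Q` and
registers in `R`. -/
structure RegTransition (A B Q R : Type*) where
  source : Q
  label : A
  test : RegTest R
  asgn : Set R
  output : List (B × R)
  target : Q

/-- Non-deterministic register transducers with finite input alphabet `A`, finite output
alphabet `B`, finite set of states `Q` and finite set of registers `R` (finiteness of these
types is assumed where transducers are used). -/
structure NRT (A B Q R : Type*) where
  initial : Q
  accepting : Set Q
  transitions : Set (RegTransition A B Q R)
  finite_transitions : transitions.Finite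

namespace NRT

variable {A B Q R D : Type*}

/-- The labelled transition relation of `T` on configurations: `T.Step c l w c'` says that `T`
can move from `c` to `c'` while reading the labelled data `l` and writing `w`. -/
def Step (T : NRT A B Q R) (c : Q × (R → D)) (l : A × D) (w : List (B × D))
    (c' : Q × (R → D)) : Prop :=
  ∃ t ∈ T.transitions,
    t.source = c.1 ∧ t.target = c'.1 ∧
    t.label = l.1 ∧
    t.test.Sat c.2 l.2 ∧
    (∀ r, (r ∈ t.asgn → c'.2 r = l.2) ∧ (r ∉ t.asgn → c'.2 r = c.2 r)) ∧
    w = t.output.map (fun p => (p.1, c'.2 p.2))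

/-- Runs of `T`: infinite sequences of configurations linked by labelled steps. -/
structure Run (T : NRT A B Q R) (D : Type*) where
  conf : ℕ → Q × (R → D)
  inp : OmegaWord (A × D)
  out : ℕ → List (B × D)
  step : ∀ n, T.Step (conf n) (inp n) (out n) (conf (n + 1))

/-- The run starts in the initial state, with `d₀` in every register. -/
def Run.IsInitial {T : NRT A B Q R} (ρ : T.Run D) (d₀ : D) : Prop :=
  ρ.conf 0 = (T.initial, fun _ => d₀)

/-- Büchi condition: some accepting state occurs infinitely often. -/
def Run.IsFinal {T : NRT A B Q R} (ρ : T.Run D) : Prop :=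
  ∃ q ∈ T.accepting, {n : ℕ | (ρ.conf n).1 = q}.Infinite

def Run.IsAccepting {T : NRT A B Q R} (ρ : T.Run D) (d₀ : D) : Prop :=
  ρ.IsInitial d₀ ∧ ρ.IsFinal

/-- Every accepting run of `T` produces an infinite output. -/
def HasInfiniteOutputs (T : NRT A B Q R) (d₀ : D) : Prop :=
  ∀ ρ : T.Run D, ρ.IsAccepting d₀ → HasInfiniteConcat ρ.out

/-- The relation between infinite data words represented by `T`. -/
def Rel (T : NRT A B Q R) (d₀ : D) (u : OmegaWord (A × D)) (v : OmegaWord (B × D)) : Prop :=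
  ∃ ρ : T.Run D, ρ.IsAccepting d₀ ∧ ρ.inp = u ∧ IsInfiniteConcat ρ.out v

/-- `T` is functional: the relation it represents is (the graph of) a partial function. -/
def IsFunctional (T : NRT A B Q R) (d₀ : D) : Prop :=
  ∀ u v v', T.Rel d₀ u v → T.Rel d₀ u v' → v = v'

/-- For a functional `T` representing the partial function `f`: `x` is in the domain of `f` and
`f` is not continuous at `x`. Continuity at `x` means that for all `i` there is `j` such that for
all `y` in the domain of `f`, if `x` and `y` have a common prefix of length at least `j`,
then `f x` and `f y` have a common prefix of length at least `i`. -/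
def IsDiscontinuousAt (T : NRT A B Q R) (d₀ : D) (x : OmegaWord (A × D)) : Prop :=
  ∃ fx, T.Rel d₀ x fx ∧
    ¬ ∀ i : ℕ, ∃ j : ℕ, ∀ y fy, T.Rel d₀ y fy →
        (j : ℕ∞) ≤ lcpLength x y → (i : ℕ∞) ≤ lcpLength fx fy

end NRT

open Filter

/-! ## Concatenations of sequences of finite words -/

/-! Only the passage from `x` to `z` needs an argument. Discontinuity at `x` gives an accepting run
`ρ` on `x` and accepting runs `σ j`, on inputs converging to `x`, whose outputs all differ from that
of `ρ` at one position `m`. As `T` is finitely branching, the `σ j` converge along an ultrafilter to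
configurations `c n` and outputs `o n` (`exists_limit_run`).

Tests see only equalities of data, so a run may be renamed by permutations varying in time, provided
the register contents keep their names (`Run.rename`). At time `n` it suffices to preserve the at
most `2k` values in the registers of `ρ` and of `c n`, together with the data `a` and `e` that `ρ`
and the limit write at position `m`. These are at most `2k + 2` values, so `X` always has a free
name for a new datum (`exists_perm_seq`). The renamed `ρ` reads `z`; the `σ j`, renamed alike up to
a time `n`, read inputs close to `z`, and the mismatch at `m` survives. -/

theorem concatUpTo_succ {S : Type*} (v : ℕ → List S) (n : ℕ) :
    concatUpTo v (n + 1) = concatUpTo v n ++ v n := by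
  simp [concatUpTo, List.range_succ]

theorem concatUpTo_congr {S : Type*} {v w : ℕ → List S} {n : ℕ} (h : ∀ i < n, v i = w i) :
    concatUpTo v n = concatUpTo w n := by
  induction n with
  | zero => rfl
  | succ n ih =>
    rw [concatUpTo_succ, concatUpTo_succ, ih fun i hi => h i (by omega), h n (by omega)]

theorem concatUpTo_getElem?_mono {S : Type*} {v : ℕ → List S} {n n' i : ℕ} {a : S}
    (hn : n ≤ n') (h : (concatUpTo v n)[i]? = some a) : (concatUpTo v n')[i]? = some a := by
  induction n', hn using Nat.le_induction with
  | base => exact h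
  | succ k _ ih =>
    rw [concatUpTo_succ, List.getElem?_append_left (List.getElem?_eq_some_iff.1 ih).1, ih]

theorem concatUpTo_getElem?_unique {S : Type*} {v : ℕ → List S} {n n' i : ℕ} {a b : S}
    (h : (concatUpTo v n)[i]? = some a) (h' : (concatUpTo v n')[i]? = some b) : a = b := by
  have h1 := concatUpTo_getElem?_mono (le_max_left n n') h
  have h2 := concatUpTo_getElem?_mono (le_max_right n n') h'
  exact Option.some.inj (h1.symm.trans h2)

theorem HasInfiniteConcat.exists_isInfiniteConcat {S : Type*} {v : ℕ → List S}
    (h : HasInfiniteConcat v) : ∃ w, IsInfiniteConcat v w := by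
  choose n hn using h
  exact ⟨fun i => (concatUpTo v (n i))[i]'(hn i), fun i => ⟨n i, by simp [hn i]⟩⟩

/-- Every letter of a concatenation of words `(v n).map (g n)` is the image under some `g s` of a
letter of `v s` at the same position of the concatenation of the `v n`. -/
theorem exists_of_concatUpTo_map_getElem? {S S' : Type*} {v : ℕ → List S} {g : ℕ → S → S'}
    {n i : ℕ} {b : S'} (h : (concatUpTo (fun n => (v n).map (g n)) n)[i]? = some b) :
    ∃ s a, (concatUpTo v (s + 1))[i]? = some a ∧ b = g s a := by
  have hlen : ∀ n, (concatUpTo (fun n => (v n).map (g n)) n).length = (concatUpTo v n).length := by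
    intro n
    simp [concatUpTo, List.length_flatMap]
  induction n with
  | zero => simp [concatUpTo] at h
  | succ n ih =>
    rcases lt_or_ge i (concatUpTo v n).length with hi | hi
    · rw [concatUpTo_succ, List.getElem?_append_left (by rwa [hlen])] at h
      exact ih h
    · rw [concatUpTo_succ, List.getElem?_append_right (by rwa [hlen]), hlen, List.getElem?_map,
        Option.map_eq_some_iff] at h
      obtain ⟨a, ha, rfl⟩ := h
      exact ⟨n, a, by rw [concatUpTo_succ, List.getElem?_append_right hi, ha], rfl⟩

theorem RegTest.sat_comp_iff {R D : Type*} (π : Equiv.Perm D) (τ : R → D) (d : D) (φ : RegTest R) :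
    φ.Sat (π ∘ τ) (π d) ↔ φ.Sat τ d := by
  induction φ <;> simp_all [RegTest.Sat]

/-! ## Sequences of permutations -/

/-- A permutation mapping a small set `K` into `X` can be changed outside of `K` so as to map
`a` into `X` as well. -/
theorem Equiv.Perm.exists_eqOn_apply_mem {D : Type*} {X K : Set D} (π : Equiv.Perm D) (a : D)
    (hK : K.encard < X.encard) (hπ : ∀ k ∈ K, π k ∈ X) :
    ∃ π' : Equiv.Perm D, (∀ k ∈ K, π' k = π k) ∧ π' a ∈ X := by
  classical
  by_cases ha : π a ∈ X
  · exact ⟨π, fun _ _ => rfl, ha⟩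
  · obtain ⟨e, heX, he⟩ : ∃ e ∈ X, e ∉ π '' K := by
      by_contra! hcon
      have h1 := Set.encard_le_encard (show X ⊆ π '' K from hcon)
      exact absurd hK (not_lt.2 (h1.trans (Set.encard_image_le _ _)))
    -- The swap moves only `π a`, which is outside `X`, and `e`, which is outside `π '' K`; so it
    -- fixes the image of `K`.
    refine ⟨π.trans (Equiv.swap (π a) e), fun k hk => ?_, by simpa using heX⟩
    refine Equiv.swap_apply_of_ne_of_ne ?_ ?_
    · rintro h
      exact ha (h ▸ hπ k hk)
    · rintro h
      exact he ⟨k, hk, h⟩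

/-- If `K n` is a sequence of small sets, whose new elements at each step are among the data
`d n`, then data can be renamed along the sequence so as to stay in `X`. -/
theorem exists_perm_seq {D : Type*} {X : Set D} {K : ℕ → Set D} {d : ℕ → D}
    (hK : ∀ n, (K n).encard < X.encard) (hsucc : ∀ n, K (n + 1) ⊆ insert (d n) (K n))
    (π₀ : Equiv.Perm D) (hπ₀ : ∀ k ∈ K 0, π₀ k ∈ X) :
    ∃ π : ℕ → Equiv.Perm D, (∀ k ∈ K 0, π 0 k = π₀ k) ∧ (∀ n, π n (d n) ∈ X) ∧
      ∀ n, ∀ k ∈ K (n + 1), π (n + 1) k = π n k := by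
  have hext : ∀ (n : ℕ) (π : Equiv.Perm D), ∃ π' : Equiv.Perm D, (∀ k ∈ K n, π k ∈ X) →
      (∀ k ∈ K n, π' k = π k) ∧ π' (d n) ∈ X := by
    intro n π
    by_cases h : ∀ k ∈ K n, π k ∈ X
    · obtain ⟨π', h'⟩ := π.exists_eqOn_apply_mem (d n) (hK n) h
      exact ⟨π', fun _ => h'⟩
    · exact ⟨π, fun h' => absurd h' h⟩
  choose F hF using hext
  let π : ℕ → Equiv.Perm D := fun n => Nat.rec (F 0 π₀) (fun n p => F (n + 1) p) n
  have key : ∀ n, (∀ k ∈ K n, π n k ∈ X) ∧ π n (d n) ∈ X := by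
    intro n
    induction n with
    | zero =>
      obtain ⟨h1, h2⟩ := hF 0 π₀ hπ₀
      exact ⟨fun k hk => by rw [show π 0 k = π₀ k from h1 k hk]; exact hπ₀ k hk, h2⟩
    | succ n ih =>
      have h0 : ∀ k ∈ K (n + 1), π n k ∈ X := by
        intro k hk
        rcases hsucc n hk with rfl | hk
        · exact ih.2
        · exact ih.1 k hk
      obtain ⟨h1, h2⟩ := hF (n + 1) (π n) h0
      exact ⟨fun k hk => by rw [show π (n + 1) k = π n k from h1 k hk]; exact h0 k hk, h2⟩
  refine ⟨π, (hF 0 π₀ hπ₀).1, fun n => (key n).2, fun n => (hF (n + 1) (π n) fun k hk => ?_).1⟩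
  rcases hsucc n hk with rfl | hk
  · exact (key n).2
  · exact (key n).1 k hk

/-! ### Renamings and limits of runs -/

namespace NRT

variable {A B Q R D : Type*}

/-- Renaming the data of a run by permutations `π n` depending on the time `n`, where the
contents of the registers are not renamed anew at any step. -/
def Run.rename {T : NRT A B Q R} (ρ : T.Run D) (π : ℕ → Equiv.Perm D)
    (hπ : ∀ n r, π (n + 1) ((ρ.conf (n + 1)).2 r) = π n ((ρ.conf (n + 1)).2 r)) : T.Run D where
  conf n := ((ρ.conf n).1, π n ∘ (ρ.conf n).2)
  inp n := ((ρ.inp n).1, π n (ρ.inp n).2)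
  out n := (ρ.out n).map (Prod.map id (π n))
  step n := by
    obtain ⟨t, ht, h1, h2, h3, h4, h5, h6⟩ := ρ.step n
    refine ⟨t, ht, h1, h2, h3, (RegTest.sat_comp_iff _ _ _ _).2 h4, fun r => ⟨fun hr => ?_,
      fun hr => ?_⟩, ?_⟩
    · exact (hπ n r).trans (congrArg (π n) ((h5 r).1 hr))
    · exact (hπ n r).trans (congrArg (π n) ((h5 r).2 hr))
    · simp [h6, hπ]

theorem Run.conf_succ_mem {T : NRT A B Q R} (ρ : T.Run D) (n : ℕ) (r : R) :
    (ρ.conf (n + 1)).2 r = (ρ.inp n).2 ∨ (ρ.conf (n + 1)).2 r = (ρ.conf n).2 r := by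
  obtain ⟨t, -, -, -, -, -, h, -⟩ := ρ.step n
  by_cases hr : r ∈ t.asgn
  · exact Or.inl ((h r).1 hr)
  · exact Or.inr ((h r).2 hr)

/-- A transition determines the new valuation and the word written. This finiteness lets an
ultrafilter select a single successor. -/
theorem finite_setOf_step (T : NRT A B Q R) (c : Q × (R → D)) (l : A × D) :
    {p : (Q × (R → D)) × List (B × D) | T.Step c l p.2 p.1}.Finite := by
  classical
  let val : RegTransition A B Q R → R → D := fun t r => if r ∈ t.asgn then l.2 else c.2 r
  refine (T.finite_transitions.image
    fun t => ((t.target, val t), t.output.map fun p => (p.1, val t p.2))).subset ?_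
  rintro ⟨⟨q, τ⟩, w⟩ ⟨t, ht, -, h2, -, -, h5, h6⟩
  have hτ : τ = val t := by
    funext r
    by_cases hr : r ∈ t.asgn
    · exact ((h5 r).1 hr).trans (if_pos hr).symm
    · exact ((h5 r).2 hr).trans (if_neg hr).symm
  subst hτ
  exact ⟨t, ht, Prod.ext (Prod.ext h2 rfl) h6.symm⟩

/-- Runs on inputs converging to `x` converge along an ultrafilter. -/
theorem exists_limit_run {T : NRT A B Q R} {d₀ : D} {x : OmegaWord (A × D)} (ρ : ℕ → T.Run D)
    (U : Ultrafilter ℕ) (h0 : ∀ j, (ρ j).IsInitial d₀)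
    (hx : ∀ n, ∀ᶠ j in U, (ρ j).inp n = x n) :
    ∃ (c : ℕ → Q × (R → D)) (o : ℕ → List (B × D)),
      (∀ n, ∀ᶠ j in U, (ρ j).conf n = c n) ∧ ∀ n, ∀ᶠ j in U, (ρ j).out n = o n := by
  have hstep : ∀ n c, (∀ᶠ j in U, (ρ j).conf n = c) →
      ∃ p : (Q × (R → D)) × List (B × D),
        ∀ᶠ j in U, (ρ j).conf (n + 1) = p.1 ∧ (ρ j).out n = p.2 := by
    intro n c hc
    have h1 : ∀ᶠ j in U, ∃ p ∈ {p : (Q × (R → D)) × List (B × D) | T.Step c (x n) p.2 p.1},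
        (ρ j).conf (n + 1) = p.1 ∧ (ρ j).out n = p.2 := by
      filter_upwards [hc, hx n] with j hj hj'
      refine ⟨((ρ j).conf (n + 1), (ρ j).out n), ?_, rfl, rfl⟩
      have := (ρ j).step n
      rwa [hj, hj'] at this
    obtain ⟨p, -, hp⟩ := (Ultrafilter.eventually_exists_mem_iff (T.finite_setOf_step c (x n))).1 h1
    exact ⟨p, hp⟩
  have hconf : ∀ n, ∃ c, ∀ᶠ j in U, (ρ j).conf n = c := by
    intro n
    induction n with
    | zero => exact ⟨_, Eventually.of_forall h0⟩
    | succ n ih =>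
      obtain ⟨c, hc⟩ := ih
      obtain ⟨p, hp⟩ := hstep n c hc
      exact ⟨p.1, hp.mono fun _ h => h.1⟩
  choose c hc using hconf
  choose p hp using fun n => hstep n (c n) (hc n)
  exact ⟨c, fun n => (p n).2, hc, fun n => (hp n).mono fun _ h => h.2⟩

/-- Discontinuity at `x` is witnessed by runs on inputs converging to `x`, whose outputs all
differ from the output on `x` at the same position. -/
theorem IsDiscontinuousAt.exists_runs {T : NRT A B Q R} {d₀ : D} {x : OmegaWord (A × D)}
    (hx : T.IsDiscontinuousAt d₀ x) :
    ∃ (ρ : T.Run D) (fx : OmegaWord (B × D)) (m : ℕ) (σ : ℕ → T.Run D)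
      (fy : ℕ → OmegaWord (B × D)),
      ρ.IsAccepting d₀ ∧ ρ.inp = x ∧ IsInfiniteConcat ρ.out fx ∧
      ∀ j, (σ j).IsAccepting d₀ ∧ IsInfiniteConcat (σ j).out (fy j) ∧
        (∀ n < j, (σ j).inp n = x n) ∧ fx m ≠ fy j m := by
  obtain ⟨fx, ⟨ρ, hρ, hρx, hρo⟩, hx⟩ := hx
  push Not at hx
  obtain ⟨i, hi⟩ := hx
  have h1 : ∃ m, ∀ j, ∃ y fy, T.Rel d₀ y fy ∧ (∀ n < j, x n = y n) ∧ fx m ≠ fy m := by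
    by_contra! hcon
    choose j hj using hcon
    -- If each position had its own modulus `j m`, their maximum over `m < i` would serve for the
    -- prefix of length `i`.
    obtain ⟨y, fy, hy, hxy, hlt⟩ := hi ((Finset.range i).sup j)
    rw [le_lcpLength_iff] at hxy
    refine absurd ((le_lcpLength_iff fx fy i).2 fun m hm => ?_) (not_le.2 hlt)
    exact hj m y fy hy fun n hn =>
      hxy n (hn.trans_le (Finset.le_sup (f := j) (Finset.mem_range.2 hm)))
  obtain ⟨m, hm⟩ := h1
  choose y fy hy hxy hne using hm
  choose σ hσ hσy hσo using hy
  exact ⟨ρ, fx, m, σ, fy, hρ, hρx, hρo, fun j =>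
    ⟨hσ j, hσo j, fun n hn => by rw [hσy, hxy j n hn], hne j⟩⟩

theorem IsDiscontinuousAt.exists_mem [Fintype R] {T : NRT A B Q R} {d₀ : D}
    (hout : T.HasInfiniteOutputs d₀) {X : Set D}
    (hX : ((2 * Fintype.card R + 3 : ℕ) : ℕ∞) ≤ X.encard) (hd₀ : d₀ ∈ X)
    {x : OmegaWord (A × D)} (hx : T.IsDiscontinuousAt d₀ x) :
    ∃ z : OmegaWord (A × D), (∀ n, (z n).2 ∈ X) ∧ T.IsDiscontinuousAt d₀ z := by
  obtain ⟨ρ, fx, m, σ, fy, hρ, rfl, hρo, hσ⟩ := hx.exists_runs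
  obtain ⟨c, o, hc, ho⟩ := exists_limit_run (d₀ := d₀) σ (hyperfilter ℕ) (fun j => (hσ j).1.1)
    fun n => ((eventually_gt_atTop n).filter_mono Nat.hyperfilter_le_atTop).mono
      fun j hj => (hσ j).2.2.1 n hj
  -- every finite part of the limit is a part of some `σ j` with `j` large
  have hlim : ∀ n, ∃ j, n < j ∧ (∀ i ≤ n, (σ j).conf i = c i) ∧ ∀ i ≤ n, (σ j).out i = o i := by
    intro n
    have h1 : ∀ᶠ j in hyperfilter ℕ, ∀ i ∈ Set.Iic n, (σ j).conf i = c i ∧ (σ j).out i = o i :=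
      (eventually_all_finite (Set.finite_Iic n)).2 fun i _ => (hc i).and (ho i)
    obtain ⟨j, hj, hnj⟩ := (h1.and ((eventually_gt_atTop n).filter_mono
      Nat.hyperfilter_le_atTop)).exists
    exact ⟨j, hnj, fun i hi => (hj i hi).1, fun i hi => (hj i hi).2⟩
  -- The limit may write only finitely many letters; if it never reaches position `m`, any value
  -- works for `e`.
  obtain ⟨e, he⟩ : ∃ e, ∀ n p, (concatUpTo o n)[m]? = some p → p.2 = e := by
    by_cases h : ∃ n p, (concatUpTo o n)[m]? = some p
    · obtain ⟨n, p, hp⟩ := h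
      exact ⟨p.2, fun n' p' hp' => by rw [concatUpTo_getElem?_unique hp hp']⟩
    · exact ⟨d₀, fun n p hp => absurd ⟨n, p, hp⟩ h⟩
  set a := (fx m).2 with ha
  let K : ℕ → Set D := fun n => (Set.range (ρ.conf n).2 ∪ Set.range (c n).2) ∪ {a, e}
  have hrange : ∀ τ : R → D, (Set.range τ).encard ≤ Fintype.card R := fun τ => by
    rw [← Set.image_univ]
    refine (Set.encard_image_le _ _).trans ?_
    simp [Set.encard_univ]
  have hpair : ∀ u v : D, ({u, v} : Set D).encard ≤ 2 := fun u v =>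
    (Set.encard_insert_le _ _).trans (by rw [Set.encard_singleton, one_add_one_eq_two])
  have hlt : ∀ {s : Set D} {n : ℕ}, s.encard ≤ n → n < 2 * Fintype.card R + 3 →
      s.encard < X.encard := fun h h' =>
    h.trans_lt (lt_of_lt_of_le (by exact_mod_cast h') hX)
  have hK : ∀ n, (K n).encard < X.encard := fun n => by
    refine hlt (n := Fintype.card R + Fintype.card R + 2) ?_ (by omega)
    refine (Set.encard_union_le _ _).trans ?_
    push_cast
    exact add_le_add ((Set.encard_union_le _ _).trans (add_le_add (hrange _) (hrange _)))
      (hpair _ _)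
  have hsucc : ∀ n, K (n + 1) ⊆ insert (ρ.inp n).2 (K n) := by
    rintro n k ((⟨r, rfl⟩ | ⟨r, rfl⟩) | hk)
    · rcases ρ.conf_succ_mem n r with h | h
      · exact Or.inl h
      · exact Or.inr (Or.inl (Or.inl ⟨r, h.symm⟩))
    · obtain ⟨j, hj, hcj, -⟩ := hlim (n + 1)
      have := (σ j).conf_succ_mem n r
      rw [hcj (n + 1) le_rfl, hcj n (by omega), (hσ j).2.2.1 n (by omega)] at this
      rcases this with h | h
      · exact Or.inl h
      · exact Or.inr (Or.inl (Or.inr ⟨r, h.symm⟩))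
    · exact Or.inr (Or.inr hk)
  -- The initial renaming must fix `d₀`, so that renamed runs remain initial, and send `a` and `e`
  -- into `X`.
  obtain ⟨π₁, h1, h1a⟩ := Equiv.Perm.exists_eqOn_apply_mem (X := X) (K := {d₀}) 1 a
    (hlt (n := 1) (by simp) (by omega)) (by simpa using hd₀)
  have h1d : π₁ d₀ = d₀ := h1 d₀ rfl
  obtain ⟨π₀, h2, h2e⟩ := π₁.exists_eqOn_apply_mem (X := X) (K := {d₀, a}) e
    (hlt (n := 2) (hpair _ _) (by omega)) (by
      rintro k (rfl | rfl)
      · rwa [h1d]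
      · exact h1a)
  have h2d : π₀ d₀ = d₀ := (h2 d₀ (by simp)).trans h1d
  have h2a : π₀ a ∈ X := by rwa [h2 a (by simp)]
  have hρ0 : ∀ r, (ρ.conf 0).2 r = d₀ := fun r => by rw [hρ.1]
  have hc0 : c 0 = (T.initial, fun _ => d₀) := by
    obtain ⟨j, -, hj, -⟩ := hlim 0
    rw [← hj 0 le_rfl]
    exact (hσ j).1.1
  obtain ⟨π, hπ0, hπX, hπ⟩ := exists_perm_seq hK hsucc π₀ (by
    rintro k ((⟨r, rfl⟩ | ⟨r, rfl⟩) | (rfl | rfl))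
    · rwa [hρ0, h2d]
    · rwa [hc0, h2d]
    · exact h2a
    · exact h2e)
  have hπa : ∀ n, π n a = π 0 a := fun n => by
    induction n with
    | zero => rfl
    | succ n ih => rw [hπ n a (by simp [K]), ih]
  have hπe : ∀ n, π n e = π 0 e := fun n => by
    induction n with
    | zero => rfl
    | succ n ih => rw [hπ n e (by simp [K]), ih]
  -- The register `r` witnesses that `d₀` belongs to `K 0`.
  have hπd : ∀ r : R, π 0 d₀ = d₀ := fun r => by
    rw [hπ0 d₀ (Or.inl (Or.inl ⟨r, hρ0 r⟩)), h2d]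
  -- the renamed run on the new input
  let ρ' : T.Run D := ρ.rename π fun n r => hπ n _ (Or.inl (Or.inl ⟨r, rfl⟩))
  have hρ' : ρ'.IsAccepting d₀ := by
    refine ⟨Prod.ext ((congrArg Prod.fst hρ.1 :)) (funext fun r => ?_), hρ.2⟩
    change π 0 ((ρ.conf 0).2 r) = d₀
    rw [hρ0, hπd r]
  obtain ⟨fz, hfz⟩ := (hout ρ' hρ').exists_isInfiniteConcat
  have hfzm : fz m = ((fx m).1, π 0 a) := by
    obtain ⟨n, hn⟩ := hfz m
    obtain ⟨s, p, hp, hps⟩ := exists_of_concatUpTo_map_getElem? hn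
    obtain ⟨n', hn'⟩ := hρo m
    rw [hps, concatUpTo_getElem?_unique hp hn', ← hπa s]
    rfl
  refine ⟨ρ'.inp, hπX, fz, ⟨ρ', hρ', rfl, hfz⟩, fun hcont => ?_⟩
  obtain ⟨n, hn⟩ := hcont (m + 1)
  obtain ⟨j, hnj, hcj, hoj⟩ := hlim n
  obtain ⟨hacc, hoy, hinp, hne⟩ := hσ j
  -- the renamed run on the new inputs close to it
  let σ' : T.Run D := (σ j).rename (fun i => π (min i n)) fun i r => by
    rcases lt_or_ge i n with hi | hi
    · simp only [min_eq_left (show i + 1 ≤ n by omega), min_eq_left hi.le]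
      exact hπ i _ (Or.inl (Or.inr ⟨r, by rw [hcj (i + 1) (by omega)]⟩))
    · simp only [min_eq_right (show n ≤ i + 1 by omega), min_eq_right hi]
  have hσ' : σ'.IsAccepting d₀ := by
    refine ⟨Prod.ext ((congrArg Prod.fst hacc.1 :)) (funext fun r => ?_), hacc.2⟩
    change π (min 0 n) (((σ j).conf 0).2 r) = d₀
    rw [hacc.1, Nat.zero_min, hπd r]
  obtain ⟨fw, hfw⟩ := (hout σ' hσ').exists_isInfiniteConcat
  have hfwm : fw m = ((fy j m).1, π n (fy j m).2) := by
    obtain ⟨N, hN⟩ := hfw m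
    obtain ⟨s, p, hp, hps⟩ := exists_of_concatUpTo_map_getElem? hN
    obtain ⟨N', hN'⟩ := hoy m
    have hpy := concatUpTo_getElem?_unique hp hN'
    rw [hps, ← hpy]
    -- A letter written before time `n` comes from the limit, so its datum is `e`, which every `π i`
    -- renames alike; a later one is renamed by `π n` itself.
    rcases lt_or_ge s n with hs | hs
    · rw [concatUpTo_congr fun i hi => hoj i (by omega)] at hp
      simp [Prod.map, he _ _ hp, hπe]
    · simp [Prod.map, min_eq_right hs]
  have hlcp := hn σ'.inp fw ⟨σ', hσ', rfl, hfw⟩ ((le_lcpLength_iff _ _ _).2 fun i hi => by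
    change ((ρ.inp i).1, π i (ρ.inp i).2) = (((σ j).inp i).1, π (min i n) ((σ j).inp i).2)
    rw [hinp i (by omega), min_eq_left hi.le])
  have heq := (le_lcpLength_iff _ _ _).1 hlcp m (by omega)
  -- Both data at position `m` are now images under the single injective map `π n`.
  rw [hfzm, hfwm, ← hπa n, Prod.mk.injEq, (π n).injective.eq_iff] at heq
  exact hne (Prod.ext heq.1 heq.2)

end NRT

theorem mainTheorem5 {A B D Q R : Type*} [Finite A] [Finite B] [Finite Q] [Fintype R]
    [Countable D] [Infinite D] (d₀ : D)
    (T : NRT A B Q R) (hout : T.HasInfiniteOutputs d₀) (hfun : T.IsFunctional d₀)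
    (X : Set D) (hX : ((2 * Fintype.card R + 3 : ℕ) : ℕ∞) ≤ X.encard) (hd₀ : d₀ ∈ X) :
    (∃ x : OmegaWord (A × D), T.IsDiscontinuousAt d₀ x) ↔
      ∃ z : OmegaWord (A × D), (∀ n, (z n).2 ∈ X) ∧ T.IsDiscontinuousAt d₀ z :=
  ⟨fun ⟨_, hx⟩ => hx.exists_mem hout hX hd₀, fun ⟨z, _, hz⟩ => ⟨z, hz⟩⟩
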